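/- A deterministic query algorithm for metric $1$-median is given, for each $n\ge 1$, the set of $n$ points of a metric space $(M,d)$ and has access to $d$ only through adaptive queries: each query names two points $x,y\in M$ and receives the value $d(x,y)$, each query and the final output point $z\in M$ being determined by the answers received so far. It is a $q(n)$-query algorithm if it makes at most $q(n)$ queries on every $n$-point metric space. A point $p\in M$ is a $\beta$-approximate $1$-median of $(M,d)$ if $\sum_{y\in M} d(p,y)\le\beta\cdot\min_{x\in M}\sum_{y\in M} d(x,y)$. Theorem. Let $q(n)=O(n)$ and let $A$ be a deterministic $q(n)$-query algorithm for metric $1$-median. Then there is a constant $\delta>0$ (which may depend on $A$) such that for all sufficiently large $n$ there is an $n$-point metric space $(M,d)$ on which the output of $A$ is not a $(\delta\log n)$-approximate $1$-median. In particular, $A$ is not $(\delta\log n)$-approximate. -/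

import Mathlib

open Filter Asymptotics

/-- A deterministic, possibly adaptive, distance-query procedure on the point set `M`: either it
halts with an output point, or it inspects the distance between two points `a`, `b` and continues
in a way that depends on the real number it receives as the answer. -/
inductive QueryTree (M : Type*) : Type _
  | output (z : M) : QueryTree M
  | query (a b : M) (next : ℝ → QueryTree M) : QueryTree M

namespace QueryTree

/-- The point output by the procedure when it is run on the metric space `M`. -/
def run {M : Type*} [MetricSpace M] : QueryTree M → M
  | output z => z
  | query a b next => run (next (dist a b))

/-- The number of queries made by the procedure when it is run on the metric space `M`. -/
def numQueries {M : Type*} [MetricSpace M] : QueryTree M → ℕ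
  | output _ => 0
  | query a b next => numQueries (next (dist a b)) + 1

end QueryTree

/-- `p` is a `β`-approximate `1`-median of the finite metric space `M`. The infimum is a minimum,
as `M` is finite and nonempty (it contains `p`). -/
def IsApproxMedian {M : Type*} [Fintype M] [MetricSpace M] (β : ℝ) (p : M) : Prop :=
  ∑ y, dist p y ≤ β * ⨅ q : M, ∑ y, dist q y

/-- A deterministic query algorithm for metric `1`-median: for each `n ≥ 1`, a procedure on the
point set `Fin n`. The metric is accessible only through the queries. -/
abbrev MedianAlgorithm : Type := (n : ℕ+) → QueryTree (Fin n)

namespace MedianAlgorithm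

/-- On every `n`-point metric space, the algorithm makes at most `q n` queries. -/
def IsQueryBounded (A : MedianAlgorithm) (q : ℕ+ → ℕ) : Prop :=
  ∀ (n : ℕ+) (m : MetricSpace (Fin n)), (@QueryTree.numQueries (Fin n) m (A n)) ≤ q n

/-- On every metric space with exactly `n` points, the output is a `β`-approximate `1`-median. -/
def IsApproximateAt (A : MedianAlgorithm) (n : ℕ+) (β : ℝ) : Prop :=
  ∀ m : MetricSpace (Fin n), @IsApproxMedian (Fin n) _ m β (@QueryTree.run (Fin n) m (A n))

end MedianAlgorithm

/-! An adversary answers each query from a shrinking metric `d` and keeps `1`-Lipschitz heights `h`.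
Distances with `d a b ≤ 5 + max (h a) (h b)` are frozen. A query of `x`, `y` raises both heights
slightly and adds an edge of length `5 + max` of the new heights: the answer is frozen, and no later
edge shortens a frozen pair.

Each query adds at most `2` to the sum of the heights, so `k` queries leave it at most `2 * k`. At
the end every `v` is joined to a virtual hub by an edge of length `5 + h v`, with `h` first raised
to about `r = log n / 2` near the output `z`. Frozen distances survive, so `z` is still the output.
The edges to the hub have total length `O(n)`, hence some point has total distance `O(n)`, whereas
`z` has total distance of order `n log n`.

Both estimates for `z` need small balls, in the form `∑ v, exp (-d u v) ≤ 3`. This follows from a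
renewal inequality over the first added edge, with kernel `K` whose row sums are controlled by
`heightPotential`: an edge at `u` costs a rise of `h u`, which increases that potential. -/

/-! ### Metrics and shortcuts -/

/-- The distance function obtained from `d` by adding an edge of length `w` between `x` and `y`. -/
noncomputable def addEdge {M : Type*} (d : M → M → ℝ) (x y : M) (w : ℝ) (a b : M) : ℝ :=
  min (d a b) (min (d a x + w + d y b) (d a y + w + d x b))

/-- The smallest function above `h` that is at least `t` at `x` and is `1`-Lipschitz for `d`. -/
noncomputable def raiseTo {M : Type*} (d : M → M → ℝ) (h : M → ℝ) (x : M) (t : ℝ) (v : M) : ℝ :=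
  max (h v) (t - d x v)

/-- `d` is a metric. -/
structure IsMetric {M : Type*} (d : M → M → ℝ) : Prop where
  self : ∀ a, d a a = 0
  symm : ∀ a b, d a b = d b a
  triangle : ∀ a b c, d a c ≤ d a b + d b c
  pos : ∀ a b, a ≠ b → 0 < d a b

namespace IsMetric

variable {M : Type*} {d : M → M → ℝ}

theorem nonneg (hd : IsMetric d) (a b : M) : 0 ≤ d a b := by
  have h1 := hd.triangle a b a
  have h2 := hd.self a
  have h3 := hd.symm a b
  linarith

/-- The metric space given by a metric. -/
@[reducible] def toMetricSpace (hd : IsMetric d) : MetricSpace M where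
  dist := d
  dist_self := hd.self
  dist_comm := hd.symm
  dist_triangle := hd.triangle
  eq_of_dist_eq_zero {a b} h := by
    by_contra hab
    exact (hd.pos a b hab).ne' h

theorem addEdge (hd : IsMetric d) (x y : M) {w : ℝ} (hw : 0 < w) :
    IsMetric (addEdge d x y w) where
  self a := by
    have h1 := hd.self a
    have h2 := hd.nonneg a x
    have h3 := hd.nonneg y a
    have h4 := hd.nonneg a y
    have h5 := hd.nonneg x a
    unfold _root_.addEdge
    rw [min_eq_left, h1]
    exact le_min (by linarith) (by linarith)
  symm a b := by
    unfold _root_.addEdge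
    rw [hd.symm a b, hd.symm a x, hd.symm y b, hd.symm a y, hd.symm x b,
      min_comm (d x a + w + d b y)]
    congr 2 <;> ring
  triangle a b c := by
    have t0 := hd.triangle a b c
    have t1 := hd.triangle a b x
    have t2 := hd.triangle a b y
    have t3 := hd.triangle y b c
    have t4 := hd.triangle x b c
    have t5 := hd.triangle a x c
    have t6 := hd.triangle a y c
    have n1 := hd.nonneg b x
    have n2 := hd.nonneg b y
    have n3 := hd.nonneg x b
    have n4 := hd.nonneg y b
    unfold _root_.addEdge
    rcases min_choice (d a b) (min (d a x + w + d y b) (d a y + w + d x b)) with h | h <;>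
    rcases min_choice (d b c) (min (d b x + w + d y c) (d b y + w + d x c)) with h' | h' <;>
    rcases min_choice (d a x + w + d y b) (d a y + w + d x b) with e | e <;>
    rcases min_choice (d b x + w + d y c) (d b y + w + d x c) with e' | e' <;>
    rw [h, h'] <;> (try rw [e]) <;> (try rw [e']) <;>
    first
      | exact (min_le_left _ _).trans (by linarith)
      | exact (min_le_right _ _).trans ((min_le_left _ _).trans (by linarith))
      | exact (min_le_right _ _).trans ((min_le_right _ _).trans (by linarith))
  pos a b hab := by
    have h1 := hd.pos a b hab
    have h2 := hd.nonneg a x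
    have h3 := hd.nonneg y b
    have h4 := hd.nonneg a y
    have h5 := hd.nonneg x b
    exact lt_min h1 (lt_min (by linarith) (by linarith))

/-- Joining every point `a` to a common hub by an edge of length `g a`. -/
theorem min_add (hd : IsMetric d) {g : M → ℝ} (hg : ∀ a, 0 < g a)
    (hlip : ∀ a b, g a ≤ g b + d a b) : IsMetric fun a b => min (d a b) (g a + g b) where
  self a := by rw [hd.self, min_eq_left]; linarith [hg a]
  symm a b := by rw [hd.symm a b, add_comm]
  triangle a b c := by
    have t0 := hd.triangle a b c
    have t1 := hlip a b
    have t2 := hlip c b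
    have t3 := hd.symm c b
    have g1 := hg b
    rcases min_choice (d a b) (g a + g b) with h | h <;>
    rcases min_choice (d b c) (g b + g c) with h' | h' <;> simp only [h, h'] <;>
    first
      | exact (min_le_left _ _).trans (by linarith)
      | exact (min_le_right _ _).trans (by linarith)
  pos a b hab := lt_min (hd.pos a b hab) (add_pos (hg a) (hg b))

end IsMetric

theorem exp_neg_le_one_sub_half {t : ℝ} (h0 : 0 ≤ t) (h1 : t ≤ 1) :
    Real.exp (-t) ≤ 1 - t / 2 := by
  have h2 := Real.add_one_le_exp t
  have h3 : Real.exp (-t) * Real.exp t = 1 := by rw [← Real.exp_add]; simp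
  have h4 := Real.exp_pos (-t)
  have h5 := Real.exp_pos t
  nlinarith

/-! ### Raising heights and the potential -/

section Raise

variable {M : Type*} {d : M → M → ℝ} {h : M → ℝ}

theorem raiseTo_lip (hd : IsMetric d) (hlip : ∀ a b, h a ≤ h b + d a b) (x : M) (t : ℝ)
    (a b : M) : raiseTo d h x t a ≤ raiseTo d h x t b + d a b := by
  unfold raiseTo
  have h1 := hd.triangle x a b
  refine max_le ?_ ?_
  · linarith [hlip a b, le_max_left (h b) (t - d x b)]
  · linarith [le_max_right (h b) (t - d x b)]

theorem le_raiseTo (d : M → M → ℝ) (h : M → ℝ) (x : M) (t : ℝ) (v : M) :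
    h v ≤ raiseTo d h x t v := le_max_left _ _

variable [Fintype M]

/-- The number of points within distance `h x + 1` of `x`. -/
noncomputable def ballCard (d : M → M → ℝ) (h : M → ℝ) (x : M) : ℕ := by
  classical exact (Finset.univ.filter fun v => d x v ≤ h x + 1).card

/-- The height function after a query at `x`. -/
noncomputable def raise (d : M → M → ℝ) (h : M → ℝ) (x : M) : M → ℝ :=
  raiseTo d h x (h x + (ballCard d h x : ℝ)⁻¹)

/-- A potential that grows whenever the height of `u` is raised; it bounds the total weight of the
edges at `u`. -/
noncomputable def heightPotential (d : M → M → ℝ) (h : M → ℝ) (u : M) : ℝ :=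
  ∑ v, max 0 (Real.exp (1 - d u v) - Real.exp (-h u))

theorem le_raise (d : M → M → ℝ) (h : M → ℝ) (x v : M) : h v ≤ raise d h x v :=
  le_max_left _ _

theorem one_le_ballCard (hd : IsMetric d) (h0 : ∀ a, 0 ≤ h a) (x : M) : 1 ≤ ballCard d h x := by
  classical
  refine Finset.card_pos.mpr ⟨x, ?_⟩
  simp only [Finset.mem_filter, Finset.mem_univ, true_and]
  rw [hd.self]
  linarith [h0 x]

theorem sum_ite_ballCard (d : M → M → ℝ) (h : M → ℝ) (x : M) (s : ℝ) :
    (∑ v, open scoped Classical in if d x v ≤ h x + 1 then s else 0) = ballCard d h x * s := by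
  classical
  rw [← Finset.sum_filter, Finset.sum_const, nsmul_eq_mul]
  unfold ballCard
  congr!

/-- Only points of the ball counted by `ballCard` can rise, each by at most the inverse of their
number; outside, `h x + 1 - d x v` is negative. -/
theorem sum_raise_le (hd : IsMetric d) (h0 : ∀ a, 0 ≤ h a) (hlip : ∀ a b, h a ≤ h b + d a b)
    (x : M) : ∑ v, raise d h x v ≤ ∑ v, h v + 1 := by
  classical
  have hN : (1 : ℝ) ≤ ballCard d h x := by exact_mod_cast one_le_ballCard hd h0 x
  have hinv : (ballCard d h x : ℝ)⁻¹ ≤ 1 := inv_le_one_of_one_le₀ hN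
  have hinv0 : 0 ≤ (ballCard d h x : ℝ)⁻¹ := by positivity
  have h1 := sum_ite_ballCard d h x (ballCard d h x : ℝ)⁻¹
  rw [mul_inv_cancel₀ (by positivity)] at h1
  rw [← h1, ← Finset.sum_add_distrib]
  refine Finset.sum_le_sum fun v _ => max_le ?_ ?_
  · split_ifs <;> linarith
  · have h2 := hlip x v
    split_ifs with h3
    · linarith
    · linarith [h0 v]

theorem heightPotential_mono {d' : M → M → ℝ} {h' : M → ℝ} (hdd : ∀ a b, d' a b ≤ d a b)
    (hh : ∀ a, h a ≤ h' a) (u : M) : heightPotential d h u ≤ heightPotential d' h' u := by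
  refine Finset.sum_le_sum fun v _ => max_le_max le_rfl ?_
  have h1 := hdd u v
  have h2 := hh u
  gcongr

/-- Each of the `N` points of the ball has an active term, which gains at least `exp (-h x) * (1 /
N) / 2`; the gain does not depend on `N`. -/
theorem heightPotential_raise (hd : IsMetric d) (h0 : ∀ a, 0 ≤ h a) (x : M) :
    heightPotential d h x + Real.exp (-h x) / 2 ≤ heightPotential d (raise d h x) x := by
  classical
  set t := (ballCard d h x : ℝ)⁻¹ with ht
  have hN : (1 : ℝ) ≤ ballCard d h x := by exact_mod_cast one_le_ballCard hd h0 x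
  have ht1 : t ≤ 1 := inv_le_one_of_one_le₀ hN
  have ht0 : 0 ≤ t := by positivity
  have h1 := sum_ite_ballCard d h x (t * (Real.exp (-h x) / 2))
  rw [← mul_assoc, mul_inv_cancel₀ (by positivity), one_mul] at h1
  have hx : h x + t ≤ raise d h x x := by
    refine le_trans ?_ (le_max_right _ _)
    rw [hd.self]; simp [ht]
  have hE : Real.exp (-raise d h x x) ≤ Real.exp (-h x) * (1 - t / 2) :=
    calc Real.exp (-raise d h x x) ≤ Real.exp (-h x + -t) := by gcongr; linarith
      _ = Real.exp (-h x) * Real.exp (-t) := Real.exp_add _ _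
      _ ≤ _ := by gcongr; exact exp_neg_le_one_sub_half ht0 ht1
  have hE' : Real.exp (-raise d h x x) ≤ Real.exp (-h x) := by
    gcongr; exact le_raise d h x x
  unfold heightPotential
  rw [← h1, ← Finset.sum_add_distrib]
  refine Finset.sum_le_sum fun v _ => ?_
  split_ifs with h3
  · have h4 : Real.exp (-h x) ≤ Real.exp (1 - d x v) := by gcongr; linarith
    rw [max_eq_right (by linarith)]
    refine le_trans ?_ (le_max_right _ _)
    linarith
  · rw [add_zero]
    exact max_le_max le_rfl (by linarith)

theorem heightPotential_le (u : M) :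
    heightPotential d h u ≤ Real.exp 1 * ∑ v, Real.exp (-d u v) := by
  unfold heightPotential
  rw [Finset.mul_sum]
  refine Finset.sum_le_sum fun v _ => ?_
  rw [← Real.exp_add, ← sub_eq_add_neg]
  exact max_le (Real.exp_pos _).le (by linarith [Real.exp_pos (-h u)])

end Raise

/-! ### The adversary and its invariants -/

/-- The state of the adversary: a metric `d` that is consistent with the answers given so far,
a height function `h`, and a kernel `K` recording the edges of the metric. -/
structure Adversary (M : Type*) [Fintype M] [DecidableEq M] where
  d : M → M → ℝ
  h : M → ℝ
  K : M → M → ℝ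
  isMetric : IsMetric d
  h_nonneg : ∀ a, 0 ≤ h a
  lip : ∀ a b, h a ≤ h b + d a b
  K_nonneg : ∀ a b, 0 ≤ K a b
  -- Renewal inequality: a shortest path is trivial, an original long edge (the `1 / n` term), or
  -- starts with an added edge from `u` to `u'`.
  exp_le : ∀ u v, Real.exp (-d u v) ≤
    (if u = v then 1 else 0) + (Fintype.card M : ℝ)⁻¹ + ∑ u', K u u' * Real.exp (-d u' v)
  K_sum_le : ∀ u, ∑ u', K u u' ≤ 2 * Real.exp (-5) * heightPotential d h u
  sum_exp_le : ∀ u, ∑ v, Real.exp (-d u v) ≤ 3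

namespace Adversary

variable {M : Type*} [Fintype M] [DecidableEq M]

/-- The pairs whose distance will not change any more. -/
def Tight (s : Adversary M) (a b : M) : Prop := s.d a b ≤ 5 + max (s.h a) (s.h b)

/-- The heights after a query of `x` and `y`. -/
noncomputable def newH (s : Adversary M) (x y : M) : M → ℝ := raise s.d (raise s.d s.h x) y

/-- The length of the edge added on a query of `x` and `y`. -/
noncomputable def newW (s : Adversary M) (x y : M) : ℝ := 5 + max (s.newH x y x) (s.newH x y y)

/-- The metric after a query of `x` and `y`. -/
noncomputable def newD (s : Adversary M) (x y : M) : M → M → ℝ := addEdge s.d x y (s.newW x y)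

/-- The kernel after a query of `x` and `y`. -/
noncomputable def newK (s : Adversary M) (x y a b : M) : ℝ :=
  s.K a b + (if a = x ∧ b = y then Real.exp (-s.newW x y) else 0)
    + (if a = y ∧ b = x then Real.exp (-s.newW x y) else 0)

variable (s : Adversary M) (x y : M)

theorem raise_nonneg (a : M) : 0 ≤ raise s.d s.h x a :=
  (s.h_nonneg a).trans (le_raise _ _ _ _)

theorem raise_lip (a b : M) : raise s.d s.h x a ≤ raise s.d s.h x b + s.d a b :=
  raiseTo_lip s.isMetric s.lip _ _ _ _

theorem raise_le_newH (a : M) : raise s.d s.h x a ≤ s.newH x y a := le_raise _ _ _ _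

theorem h_le_newH (a : M) : s.h a ≤ s.newH x y a :=
  (le_raise _ _ _ _).trans (s.raise_le_newH x y a)

theorem newH_nonneg (a : M) : 0 ≤ s.newH x y a := (s.h_nonneg a).trans (s.h_le_newH x y a)

theorem newH_lip_d (a b : M) : s.newH x y a ≤ s.newH x y b + s.d a b :=
  raiseTo_lip s.isMetric (s.raise_lip x) _ _ _ _

theorem sum_newH_le : ∑ v, s.newH x y v ≤ ∑ v, s.h v + 2 := by
  have h1 := sum_raise_le s.isMetric s.h_nonneg s.lip x
  have h2 := sum_raise_le s.isMetric (s.raise_nonneg x) (s.raise_lip x) y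
  unfold newH
  linarith

theorem five_le_newW : 5 ≤ s.newW x y := by
  unfold newW
  linarith [s.newH_nonneg x y x, le_max_left (s.newH x y x) (s.newH x y y)]

theorem newH_left_le : 5 + s.newH x y x ≤ s.newW x y := by
  unfold newW; linarith [le_max_left (s.newH x y x) (s.newH x y y)]

theorem newH_right_le : 5 + s.newH x y y ≤ s.newW x y := by
  unfold newW; linarith [le_max_right (s.newH x y x) (s.newH x y y)]

theorem newD_le (a b : M) : s.newD x y a b ≤ s.d a b := min_le_left _ _

theorem newD_le_left (a b : M) : s.newD x y a b ≤ s.d a x + s.newW x y + s.d y b :=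
  (min_le_right _ _).trans (min_le_left _ _)

theorem newD_le_right (a b : M) : s.newD x y a b ≤ s.d a y + s.newW x y + s.d x b :=
  (min_le_right _ _).trans (min_le_right _ _)

theorem isMetric_newD : IsMetric (s.newD x y) :=
  s.isMetric.addEdge x y (by linarith [s.five_le_newW x y])

/-- By the Lipschitz property a detour over the new edge, of length at least `5` plus the height of
either end, is at least `5` plus the height of `a` and of `b`. -/
theorem newD_eq_of_le {a b : M} (hab : s.d a b ≤ 5 + max (s.newH x y a) (s.newH x y b)) :
    s.newD x y a b = s.d a b := by
  refine min_eq_left (hab.trans ?_)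
  have h1 := s.newH_left_le x y
  have h2 := s.newH_right_le x y
  have l1 := s.newH_lip_d x y a x
  have l2 := s.newH_lip_d x y a y
  have l3 := s.newH_lip_d x y b x
  have l4 := s.newH_lip_d x y b y
  have e1 := s.isMetric.symm b x
  have e2 := s.isMetric.symm b y
  have n1 := s.isMetric.nonneg a x
  have n2 := s.isMetric.nonneg a y
  have n3 := s.isMetric.nonneg x b
  have n4 := s.isMetric.nonneg y b
  rcases max_choice (s.newH x y a) (s.newH x y b) with h | h <;> rw [h] <;>
    exact le_min (by linarith) (by linarith)

theorem newH_lip (a b : M) : s.newH x y a ≤ s.newH x y b + s.newD x y a b := by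
  have h1 := s.newH_left_le x y
  have h2 := s.newH_right_le x y
  have l0 := s.newH_lip_d x y a b
  have l1 := s.newH_lip_d x y a x
  have l2 := s.newH_lip_d x y a y
  have n3 := s.isMetric.nonneg x b
  have n4 := s.isMetric.nonneg y b
  have n5 := s.newH_nonneg x y b
  rw [← sub_le_iff_le_add']
  exact le_min (by linarith) (le_min (by linarith) (by linarith))

theorem newK_nonneg (a b : M) : 0 ≤ s.newK x y a b := by
  unfold newK
  have h1 := s.K_nonneg a b
  have h2 := (Real.exp_pos (-s.newW x y)).le
  split_ifs <;> linarith

theorem sum_newK_mul (u : M) (f : M → ℝ) : ∑ u', s.newK x y u u' * f u' =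
    ∑ u', s.K u u' * f u' + (if u = x then Real.exp (-s.newW x y) * f y else 0)
      + (if u = y then Real.exp (-s.newW x y) * f x else 0) := by
  unfold newK
  simp only [add_mul, Finset.sum_add_distrib, ite_mul, zero_mul, ite_and]
  congr 1
  · congr 1
    split_ifs <;> simp
  · split_ifs <;> simp

/-! ### Exponential sums stay bounded -/

theorem exp_newD_le (u v : M) : Real.exp (-s.newD x y u v) ≤
    (if u = v then 1 else 0) + (Fintype.card M : ℝ)⁻¹ +
      ∑ u', s.newK x y u u' * Real.exp (-s.newD x y u' v) := by
  have hc : (0 : ℝ) ≤ (Fintype.card M : ℝ)⁻¹ := by positivity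
  have hi : (0 : ℝ) ≤ if u = v then 1 else 0 := by split_ifs <;> norm_num
  have hW := s.five_le_newW x y
  -- For a path over the new edge, the old renewal inequality is applied to its part from `u` to `p`
  -- and multiplied by the weight `E` of the rest. The diagonal term becomes the new kernel entry.
  have path : ∀ p q : M, (∀ a, s.newD x y a v ≤ s.d a p + s.newW x y + s.d q v) →
      Real.exp (-(s.d u p + s.newW x y + s.d q v)) ≤ (if u = p then
        Real.exp (-s.newW x y) * Real.exp (-s.newD x y q v) else 0) + (Fintype.card M : ℝ)⁻¹ +
      ∑ u', s.K u u' * Real.exp (-s.newD x y u' v) := by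
    intro p q hpq
    set E := Real.exp (-(s.newW x y + s.d q v)) with hE
    have hE0 : 0 < E := Real.exp_pos _
    have hE1 : E ≤ 1 := by
      rw [hE, Real.exp_le_one_iff]
      linarith [s.isMetric.nonneg q v]
    have h1 : Real.exp (-(s.d u p + s.newW x y + s.d q v)) = Real.exp (-s.d u p) * E := by
      rw [hE, ← Real.exp_add]; ring_nf
    rw [h1]
    refine (mul_le_mul_of_nonneg_right (s.exp_le u p) hE0.le).trans ?_
    rw [add_mul, add_mul, Finset.sum_mul]
    refine add_le_add (add_le_add ?_ ?_) ?_
    · split_ifs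
      · rw [one_mul, hE, ← Real.exp_add]
        gcongr
        linarith [s.newD_le x y q v]
      · simp
    · exact mul_le_of_le_one_right hc hE1
    · refine Finset.sum_le_sum fun u' _ => ?_
      rw [mul_assoc]
      refine mul_le_mul_of_nonneg_left ?_ (s.K_nonneg u u')
      rw [hE, ← Real.exp_add]
      gcongr
      linarith [hpq u']
  have hx : (0 : ℝ) ≤ if u = x then Real.exp (-s.newW x y) * Real.exp (-s.newD x y y v) else 0 := by
    split_ifs <;> positivity
  have hy : (0 : ℝ) ≤ if u = y then Real.exp (-s.newW x y) * Real.exp (-s.newD x y x v) else 0 := by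
    split_ifs <;> positivity
  rw [sum_newK_mul]
  have cases3 : s.newD x y u v = s.d u v ∨ s.newD x y u v = s.d u x + s.newW x y + s.d y v ∨
      s.newD x y u v = s.d u y + s.newW x y + s.d x v := by
    unfold newD addEdge
    rcases min_choice (s.d u v)
      (min (s.d u x + s.newW x y + s.d y v) (s.d u y + s.newW x y + s.d x v)) with h | h
    · exact Or.inl h
    · rw [h]; exact Or.inr (min_choice _ _)
  rcases cases3 with h | h | h
  · have h1 := s.exp_le u v
    have h2 : ∑ u', s.K u u' * Real.exp (-s.d u' v) ≤
        ∑ u', s.K u u' * Real.exp (-s.newD x y u' v) := by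
      refine Finset.sum_le_sum fun u' _ => mul_le_mul_of_nonneg_left ?_ (s.K_nonneg u u')
      have := s.newD_le x y u' v
      gcongr
    rw [← h] at h1
    linarith
  · have h1 := path x y (fun a => s.newD_le_left x y a v)
    rw [← h] at h1
    linarith
  · have h1 := path y x (fun a => s.newD_le_right x y a v)
    rw [← h] at h1
    linarith

theorem heightPotential_newH_left :
    heightPotential s.d s.h x + Real.exp (-s.newH x y x) / 2 ≤
      heightPotential s.d (raise s.d s.h x) x := by
  have h1 := heightPotential_raise s.isMetric s.h_nonneg x
  have h2 : Real.exp (-s.newH x y x) ≤ Real.exp (-s.h x) := by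
    gcongr; exact s.h_le_newH x y x
  linarith

theorem heightPotential_newH_right :
    heightPotential s.d (raise s.d s.h x) y + Real.exp (-s.newH x y y) / 2 ≤
      heightPotential s.d (s.newH x y) y := by
  have h1 := heightPotential_raise s.isMetric (s.raise_nonneg x) y
  have h2 : Real.exp (-s.newH x y y) ≤ Real.exp (-raise s.d s.h x y) := by
    gcongr; exact s.raise_le_newH x y y
  unfold newH at *
  linarith

/-- An edge at `u` weighs at most `exp (-5) * exp (-h u)` for the new height, while the rise of `h
u` gains half of `exp (-h u)` in potential; hence the factor `2 * exp (-5)`. -/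
theorem newK_sum_le (u : M) :
    ∑ u', s.newK x y u u' ≤ 2 * Real.exp (-5) * heightPotential (s.newD x y) (s.newH x y) u := by
  have h0 := s.sum_newK_mul x y u (fun _ => 1)
  simp only [mul_one] at h0
  rw [h0]
  have h1 := s.K_sum_le u
  have m1 := heightPotential_mono (d := s.d) (d' := s.d) (fun _ _ => le_rfl) (le_raise s.d s.h x) u
  have m2 := heightPotential_mono (d := s.d) (d' := s.d) (fun _ _ => le_rfl) (s.raise_le_newH x y) u
  have m3 := heightPotential_mono (h := s.newH x y) (s.newD_le x y) (fun _ => le_rfl) u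
  have e5 := Real.exp_pos (-5)
  have a1 : heightPotential s.d s.h u + (if u = x then Real.exp (-s.newH x y x) / 2 else 0) ≤
      heightPotential s.d (raise s.d s.h x) u := by
    split_ifs with hu
    · subst hu; exact s.heightPotential_newH_left u y
    · simpa using m1
  have a2 : heightPotential s.d (raise s.d s.h x) u +
      (if u = y then Real.exp (-s.newH x y y) / 2 else 0) ≤
      heightPotential s.d (s.newH x y) u := by
    split_ifs with hu
    · subst hu; exact s.heightPotential_newH_right x u
    · simpa using m2
  have b1 : Real.exp (-s.newW x y) ≤ Real.exp (-5) * Real.exp (-s.newH x y x) := by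
    rw [← Real.exp_add]; gcongr; linarith [s.newH_left_le x y]
  have b2 : Real.exp (-s.newW x y) ≤ Real.exp (-5) * Real.exp (-s.newH x y y) := by
    rw [← Real.exp_add]; gcongr; linarith [s.newH_right_le x y]
  have c1 : (if u = x then Real.exp (-s.newW x y) else 0) ≤
      2 * Real.exp (-5) * (if u = x then Real.exp (-s.newH x y x) / 2 else 0) := by
    split_ifs <;> linarith
  have c2 : (if u = y then Real.exp (-s.newW x y) else 0) ≤
      2 * Real.exp (-5) * (if u = y then Real.exp (-s.newH x y y) / 2 else 0) := by
    split_ifs <;> linarith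
  have key := mul_le_mul_of_nonneg_left (show heightPotential s.d s.h u +
      (if u = x then Real.exp (-s.newH x y x) / 2 else 0) +
      (if u = y then Real.exp (-s.newH x y y) / 2 else 0) ≤
      heightPotential (s.newD x y) (s.newH x y) u by linarith)
    (show 0 ≤ 2 * Real.exp (-5) by positivity)
  rw [mul_add, mul_add] at key
  linarith

theorem exp_neg_four_le : Real.exp (-4) ≤ 1 / 32 := by
  have h2 : (2.7 : ℝ) ≤ Real.exp 1 := by linarith [Real.exp_one_gt_d9]
  have h3 : Real.exp 4 = Real.exp 1 ^ 4 := by rw [← Real.exp_nat_mul]; norm_num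
  have h4 : (32 : ℝ) ≤ Real.exp 4 := by
    rw [h3]
    calc (32 : ℝ) ≤ 2.7 ^ 4 := by norm_num
      _ ≤ _ := by gcongr
  rw [Real.exp_neg, ← one_div]
  exact one_div_le_one_div_of_le (by norm_num) h4

/-- A priori bound for the bootstrap: one edge, used in two directions, adds at most `2 * 3 / 32` to
the old bound `3`. -/
theorem sum_exp_newD_le_four (u : M) : ∑ v, Real.exp (-s.newD x y u v) ≤ 4 := by
  have hW := s.five_le_newW x y
  have path : ∀ p q : M, ∑ v, Real.exp (-(s.d u p + s.newW x y + s.d q v)) ≤ 3 / 32 := by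
    intro p q
    have h1 : ∀ v, Real.exp (-(s.d u p + s.newW x y + s.d q v)) ≤
        1 / 32 * Real.exp (-s.d q v) := by
      intro v
      have h2 : Real.exp (-(s.d u p + s.newW x y + s.d q v)) ≤
          Real.exp (-4) * Real.exp (-s.d q v) := by
        rw [← Real.exp_add]
        gcongr
        linarith [s.isMetric.nonneg u p]
      exact h2.trans (by gcongr; exact exp_neg_four_le)
    refine (Finset.sum_le_sum fun v _ => h1 v).trans ?_
    rw [← Finset.mul_sum]
    linarith [s.sum_exp_le q]
  have h3 : ∀ v, Real.exp (-s.newD x y u v) ≤ Real.exp (-s.d u v) +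
      Real.exp (-(s.d u x + s.newW x y + s.d y v)) +
      Real.exp (-(s.d u y + s.newW x y + s.d x v)) := by
    intro v
    have p1 := Real.exp_pos (-s.d u v)
    have p2 := Real.exp_pos (-(s.d u x + s.newW x y + s.d y v))
    have p3 := Real.exp_pos (-(s.d u y + s.newW x y + s.d x v))
    unfold newD addEdge
    rcases min_choice (s.d u v)
      (min (s.d u x + s.newW x y + s.d y v) (s.d u y + s.newW x y + s.d x v)) with h | h
    · rw [h]; linarith
    · rw [h]
      rcases min_choice (s.d u x + s.newW x y + s.d y v) (s.d u y + s.newW x y + s.d x v)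
        with h | h <;> rw [h] <;> linarith
  refine (Finset.sum_le_sum fun v _ => h3 v).trans ?_
  rw [Finset.sum_add_distrib, Finset.sum_add_distrib]
  linarith [path x y, path y x, s.sum_exp_le u]

/-- Summing the renewal inequality over `v`: with the a priori bound `4`, the rows of the kernel sum
to at most `8 * exp (-4) ≤ 1 / 4`, so the total is at most `1 + 1 + 4 / 4 = 3`. The bound does not
deteriorate from query to query. -/
theorem sum_exp_newD_le (u : M) : ∑ v, Real.exp (-s.newD x y u v) ≤ 3 := by
  have h1 := Finset.sum_le_sum fun v (_ : v ∈ Finset.univ) => s.exp_newD_le x y u v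
  rw [Finset.sum_add_distrib, Finset.sum_add_distrib, Finset.sum_comm] at h1
  have hcard : (Fintype.card M : ℝ) ≠ 0 := by
    have : Nonempty M := ⟨x⟩
    exact_mod_cast Fintype.card_ne_zero
  simp only [Finset.sum_ite_eq, Finset.mem_univ, if_true, Finset.sum_const, Finset.card_univ,
    nsmul_eq_mul, mul_inv_cancel₀ hcard, ← Finset.mul_sum] at h1
  have h2 : ∑ u', s.newK x y u u' * ∑ v, Real.exp (-s.newD x y u' v) ≤
      (∑ u', s.newK x y u u') * 4 := by
    rw [Finset.sum_mul]
    exact Finset.sum_le_sum fun u' _ =>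
      mul_le_mul_of_nonneg_left (s.sum_exp_newD_le_four x y u') (s.newK_nonneg x y u u')
  have h3 := s.newK_sum_le x y u
  have h4 : 2 * Real.exp (-5) * heightPotential (s.newD x y) (s.newH x y) u ≤
      2 * Real.exp (-5) * (Real.exp 1 * 4) := by
    gcongr
    exact (heightPotential_le u).trans (by gcongr; exact s.sum_exp_newD_le_four x y u)
  have h5 : 2 * Real.exp (-5) * (Real.exp 1 * 4) = 8 * Real.exp (-4) := by
    rw [show (-4 : ℝ) = -5 + 1 by norm_num, Real.exp_add]; ring
  linarith [exp_neg_four_le]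

/-- The state of the adversary after a query of `x` and `y`. -/
noncomputable def step : Adversary M where
  d := s.newD x y
  h := s.newH x y
  K := s.newK x y
  isMetric := s.isMetric_newD x y
  h_nonneg := s.newH_nonneg x y
  lip := s.newH_lip x y
  K_nonneg := s.newK_nonneg x y
  exp_le := s.exp_newD_le x y
  K_sum_le := s.newK_sum_le x y
  sum_exp_le := s.sum_exp_newD_le x y

/-- The state of the adversary before the first query. -/
noncomputable def start (M : Type*) [Fintype M] [DecidableEq M] [Nonempty M] : Adversary M where
  -- Large enough that `exp (-d a b) ≤ 1 / n` off the diagonal.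
  d a b := if a = b then 0 else Real.log (Fintype.card M) + 1
  h _ := 0
  K _ _ := 0
  isMetric := by
    have hL : 0 ≤ Real.log (Fintype.card M) := Real.log_natCast_nonneg _
    refine ⟨fun a => by simp, fun a b => by simp [eq_comm], fun a b c => ?_, fun a b hab => ?_⟩
    · split_ifs <;> first | linarith | (simp_all)
    · rw [if_neg hab]; linarith
  h_nonneg _ := le_rfl
  lip a b := by
    have hL : 0 ≤ Real.log (Fintype.card M) := Real.log_natCast_nonneg _
    split_ifs <;> linarith
  K_nonneg _ _ := le_rfl
  exp_le u v := by
    have hc : (0 : ℝ) < Fintype.card M := by exact_mod_cast Fintype.card_pos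
    have hc' : (0 : ℝ) < (Fintype.card M : ℝ)⁻¹ := by positivity
    by_cases huv : u = v
    · simp [huv]
    · simp only [huv, if_false, zero_mul, Finset.sum_const_zero, add_zero, zero_add]
      calc Real.exp (-(Real.log (Fintype.card M) + 1))
          ≤ Real.exp (-Real.log (Fintype.card M)) := by gcongr; linarith
        _ = _ := by rw [Real.exp_neg, Real.exp_log hc]
  K_sum_le u := by
    rw [Finset.sum_const_zero]
    refine mul_nonneg (by positivity) (Finset.sum_nonneg fun v _ => le_max_left _ _)
  sum_exp_le u := by
    have hc : (0 : ℝ) < Fintype.card M := by exact_mod_cast Fintype.card_pos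
    have h1 : ∀ v, Real.exp (-(if u = v then 0 else Real.log (Fintype.card M) + 1)) ≤
        (if u = v then 1 else 0) + (Fintype.card M : ℝ)⁻¹ := by
      intro v
      split_ifs
      · simp
      · rw [zero_add]
        calc Real.exp (-(Real.log (Fintype.card M) + 1))
            ≤ Real.exp (-Real.log (Fintype.card M)) := by gcongr; linarith
          _ = _ := by rw [Real.exp_neg, Real.exp_log hc]
    refine (Finset.sum_le_sum fun v _ => h1 v).trans ?_
    rw [Finset.sum_add_distrib]
    simp [hc.ne']
    norm_num

/-! ### Playing the game and adding the hub -/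

/-- The metric space `m` agrees with all the distances the adversary is committed to. -/
def Agrees (s : Adversary M) (m : MetricSpace M) : Prop :=
  ∀ a b, s.Tight a b → @dist M m.toDist a b = s.d a b

variable {s x y}

theorem Tight.step {a b : M} (hab : s.Tight a b) :
    (s.step x y).Tight a b ∧ (s.step x y).d a b = s.d a b := by
  have h1 : s.d a b ≤ 5 + max (s.newH x y a) (s.newH x y b) :=
    hab.trans (by gcongr <;> exact s.h_le_newH x y _)
  exact ⟨(s.newD_le x y a b).trans h1, s.newD_eq_of_le x y h1⟩

theorem tight_step : (s.step x y).Tight x y := by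
  have h1 := s.newD_le_left x y x y
  rw [s.isMetric.self, s.isMetric.self, zero_add, add_zero] at h1
  exact h1

/-- Playing against the adversary: the queries end in a state `s'` such that the procedure behaves
in the same way on all metric spaces that agree with `s'`. -/
theorem exists_play (T : QueryTree M) (s : Adversary M) :
    ∃ (s' : Adversary M) (z : M) (k : ℕ),
      (∀ a b, s.Tight a b → s'.Tight a b ∧ s'.d a b = s.d a b) ∧
      ∑ v, s'.h v ≤ ∑ v, s.h v + 2 * k ∧
      ∀ m : MetricSpace M, s'.Agrees m →
        @QueryTree.run M m T = z ∧ @QueryTree.numQueries M m T = k := by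
  induction T generalizing s with
  | output z => exact ⟨s, z, 0, fun a b h => ⟨h, rfl⟩, by simp, fun m _ => ⟨rfl, rfl⟩⟩
  | query x y next ih =>
    obtain ⟨s', z, k, h1, h2, h3⟩ := ih ((s.step x y).d x y) (s.step x y)
    refine ⟨s', z, k + 1, fun a b hab => ?_, ?_, fun m hm => ?_⟩
    · obtain ⟨e1, e2⟩ := hab.step (x := x) (y := y)
      obtain ⟨e3, e4⟩ := h1 a b e1
      exact ⟨e3, e4.trans e2⟩
    · have := s.sum_newH_le x y
      change _ ≤ ∑ v, s.newH x y v + 2 * (k : ℝ) at h2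
      push_cast
      linarith
    · obtain ⟨e1, e2⟩ := h1 x y tight_step
      obtain ⟨e3, e4⟩ := h3 m hm
      have e5 := hm x y e1
      rw [e2] at e5
      simp only [QueryTree.run, QueryTree.numQueries]
      rw [e5]
      exact ⟨e3, by rw [e4]⟩

/-- The distance of a point to the hub that makes `z` a bad median. -/
noncomputable def hubDist (s : Adversary M) (z : M) (r : ℝ) (v : M) : ℝ :=
  5 + raiseTo s.d s.h z r v

theorem five_add_h_le_hubDist (s : Adversary M) (z : M) (r : ℝ) (v : M) :
    5 + s.h v ≤ s.hubDist z r v := by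
  unfold hubDist
  linarith [le_raiseTo s.d s.h z r v]

theorem hubDist_pos (s : Adversary M) (z : M) (r : ℝ) (v : M) : 0 < s.hubDist z r v := by
  linarith [s.five_add_h_le_hubDist z r v, s.h_nonneg v]

theorem isMetric_hub (s : Adversary M) (z : M) (r : ℝ) :
    IsMetric fun a b => min (s.d a b) (s.hubDist z r a + s.hubDist z r b) :=
  s.isMetric.min_add (s.hubDist_pos z r) fun a b => by
    unfold hubDist
    linarith [raiseTo_lip s.isMetric s.lip z r a b]

theorem agrees_hub (s : Adversary M) (z : M) (r : ℝ) :
    s.Agrees (s.isMetric_hub z r).toMetricSpace := by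
  intro a b hab
  refine min_eq_left (hab.trans ?_)
  have h1 := s.five_add_h_le_hubDist z r a
  have h2 := s.five_add_h_le_hubDist z r b
  have h3 := s.h_nonneg a
  have h4 := s.h_nonneg b
  rcases max_choice (s.h a) (s.h b) with h | h <;> rw [h] <;> linarith

/-- Uses `t ≤ exp t` and the exponential sum at `z`: few points lie much closer to `z` than `r`. -/
theorem sum_sub_le (s : Adversary M) (z : M) (r : ℝ) :
    ∑ v, max 0 (r - s.d z v) ≤ 3 * Real.exp r := by
  calc ∑ v, max 0 (r - s.d z v) ≤ ∑ v, Real.exp r * Real.exp (-s.d z v) := by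
        refine Finset.sum_le_sum fun v _ => ?_
        rw [← Real.exp_add]
        exact max_le (Real.exp_pos _).le (by linarith [Real.add_one_le_exp (r + -s.d z v)])
    _ ≤ _ := by
        rw [← Finset.mul_sum]
        nlinarith [s.sum_exp_le z, Real.exp_pos r]

theorem sum_hubDist_le (s : Adversary M) (z : M) (r : ℝ) :
    ∑ v, s.hubDist z r v ≤ 5 * Fintype.card M + ∑ v, s.h v + 3 * Real.exp r := by
  have h1 : ∀ v, s.hubDist z r v ≤ 5 + s.h v + max 0 (r - s.d z v) := by
    intro v
    unfold hubDist raiseTo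
    rcases max_choice (s.h v) (r - s.d z v) with h | h <;> rw [h]
    · linarith [le_max_left 0 (r - s.d z v)]
    · linarith [le_max_right 0 (r - s.d z v), s.h_nonneg v]
  refine (Finset.sum_le_sum fun v _ => h1 v).trans ?_
  rw [Finset.sum_add_distrib, Finset.sum_add_distrib]
  have := s.sum_sub_le z r
  simp only [Finset.sum_const, Finset.card_univ, nsmul_eq_mul]
  linarith

theorem le_sum_hub (s : Adversary M) (z : M) (r : ℝ) :
    Fintype.card M * r - 3 * Real.exp r ≤
      ∑ v, min (s.d z v) (s.hubDist z r z + s.hubDist z r v) := by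
  have h1 : ∀ v, r - max 0 (r - s.d z v) ≤
      min (s.d z v) (s.hubDist z r z + s.hubDist z r v) := by
    intro v
    have h2 := s.hubDist_pos z r v
    have h3 : r ≤ s.hubDist z r z := by
      unfold hubDist raiseTo
      rw [s.isMetric.self, sub_zero]
      linarith [le_max_right (s.h z) r]
    refine le_min ?_ ?_
    · linarith [le_max_right 0 (r - s.d z v)]
    · linarith [le_max_left 0 (r - s.d z v)]
  have h4 := Finset.sum_le_sum fun v (_ : v ∈ Finset.univ) => h1 v
  rw [Finset.sum_sub_distrib] at h4
  simp only [Finset.sum_const, Finset.card_univ, nsmul_eq_mul] at h4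
  linarith [s.sum_sub_le z r]

end Adversary

/-! ### Averaging and the choice of constants -/

/-- If all distances are at most `g a + g b`, then some point has total distance at most
`2 * ∑ v, g v`. -/
theorem iInf_sum_le {M : Type*} [Fintype M] [Nonempty M] {D : M → M → ℝ} {g : M → ℝ}
    (h : ∀ a b, D a b ≤ g a + g b) : ⨅ p, ∑ v, D p v ≤ 2 * ∑ v, g v := by
  have hc : (0 : ℝ) < Fintype.card M := by exact_mod_cast Fintype.card_pos
  have h1 : ∀ p, ⨅ p, ∑ v, D p v ≤ ∑ v, (g p + g v) := fun p =>
    (ciInf_le (Set.finite_range _).bddBelow p).trans (Finset.sum_le_sum fun v _ => h p v)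
  -- Averaging over `p`: the mean of `g p` accounts for the second copy of `∑ v, g v`.
  have h2 := Finset.sum_le_sum fun p (_ : p ∈ Finset.univ) => h1 p
  simp only [Finset.sum_add_distrib, Finset.sum_const, Finset.card_univ, nsmul_eq_mul,
    ← Finset.mul_sum] at h2
  nlinarith

/-- A procedure with at most `k` queries fails on some metric space. -/
theorem exists_hard_metric {M : Type*} [Fintype M] [Nonempty M] (T : QueryTree M) {k : ℕ}
    (hT : ∀ m : MetricSpace M, @QueryTree.numQueries M m T ≤ k) (r : ℝ) :
    ∃ m : MetricSpace M, ∀ β : ℝ, 0 ≤ β → @IsApproxMedian M _ m β (@QueryTree.run M m T) →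
      Fintype.card M * r - 3 * Real.exp r ≤
        β * (2 * (5 * Fintype.card M + 2 * k + 3 * Real.exp r)) := by
  classical
  obtain ⟨s, z, j, -, h2, h3⟩ := Adversary.exists_play T (Adversary.start M)
  refine ⟨(s.isMetric_hub z r).toMetricSpace, fun β hβ happ => ?_⟩
  obtain ⟨e1, e2⟩ := h3 _ (s.agrees_hub z r)
  have hj : (j : ℝ) ≤ k := by
    have := hT (s.isMetric_hub z r).toMetricSpace
    rw [e2] at this
    exact_mod_cast this
  rw [e1] at happ
  have h4 := s.le_sum_hub z r
  have h5 : (⨅ p, ∑ v, min (s.d p v) (s.hubDist z r p + s.hubDist z r v)) ≤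
      2 * ∑ v, s.hubDist z r v := iInf_sum_le fun a b => min_le_right _ _
  have h6 := s.sum_hubDist_le z r
  have h7 : ∑ v, (Adversary.start M).h v = 0 := Finset.sum_const_zero
  refine h4.trans (le_trans happ (mul_le_mul_of_nonneg_left (h5.trans ?_) hβ))
  linarith

theorem mainTheorem3 (A : MedianAlgorithm) (q : ℕ+ → ℕ)
    (hq : (fun n : ℕ+ => (q n : ℝ)) =O[atTop] (fun n : ℕ+ => ((n : ℕ) : ℝ)))
    (hA : A.IsQueryBounded q) :
    ∃ δ : ℝ, 0 < δ ∧
      ∀ᶠ n : ℕ+ in atTop, ¬ A.IsApproximateAt n (δ * Real.log ((n : ℕ) : ℝ)) := by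
  obtain ⟨C, hC, hqC⟩ := hq.exists_pos
  -- With `q n ≤ C * n` and `exp r ≤ n`, twice the sum of the hub distances is at most `(16 + 4 * C)
  -- * n`. An approximate median would give `n * l / 2 - 3 * n ≤ n * l / 4` for `l = log n`, that is
  -- `l ≤ 12`.
  refine ⟨1 / (4 * (16 + 4 * C)), by positivity, ?_⟩
  have hlog : ∀ᶠ n : ℕ+ in atTop, (13 : ℝ) ≤ Real.log ((n : ℕ) : ℝ) :=
    (Real.tendsto_log_atTop.comp (tendsto_natCast_atTop_atTop.comp
      (tendsto_atTop_atTop.mpr fun b => ⟨b.succPNat, fun n hn =>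
        (Nat.le_succ b).trans (PNat.coe_le_coe _ _ |>.mpr hn)⟩))).eventually_ge_atTop 13
  filter_upwards [hqC.bound, hlog] with n hn hl happ
  have hn1 : (1 : ℝ) ≤ (n : ℕ) := by exact_mod_cast n.pos
  have : Nonempty (Fin n) := ⟨⟨0, n.pos⟩⟩
  obtain ⟨m, hm⟩ := exists_hard_metric (A n) (hA n) (Real.log ((n : ℕ) : ℝ) / 2)
  have h1 := hm _ (by positivity) (happ m)
  have hexp : Real.exp (Real.log ((n : ℕ) : ℝ) / 2) ≤ (n : ℕ) :=
    calc Real.exp (Real.log ((n : ℕ) : ℝ) / 2) ≤ Real.exp (Real.log ((n : ℕ) : ℝ)) := by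
          gcongr; linarith
      _ = _ := Real.exp_log (by linarith)
  rw [Fintype.card_fin] at h1
  rw [Real.norm_natCast, Real.norm_natCast] at hn
  set l := Real.log ((n : ℕ) : ℝ) with hl'
  set N : ℝ := ((n : ℕ) : ℝ) with hN
  have h2 : 1 / (4 * (16 + 4 * C)) * l * (2 * (5 * N + 2 * (q n) + 3 * Real.exp (l / 2))) ≤
      1 / (4 * (16 + 4 * C)) * l * (N * (16 + 4 * C)) := by
    refine mul_le_mul_of_nonneg_left ?_ (by positivity)
    linarith
  have h3 : 1 / (4 * (16 + 4 * C)) * l * (N * (16 + 4 * C)) = N * l / 4 := by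
    field_simp
  nlinarith
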